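/- Consider a game with partial monitoring: finite action sets $\mathcal I$ and $\mathcal J$, a finite set $\mathcal H$ of signals, a payoff function $r:\mathcal I\times\mathcal J\to\mathbb R^d$ and a signaling structure $H:\mathcal I\times\mathcal J\to\Delta(\mathcal H)$, where $\Delta(X)$ denotes the set of probability distributions over a finite set $X$. For $\mathbf p\in\Delta(\mathcal I)$ and $\mathbf q\in\Delta(\mathcal J)$ let $r(\mathbf p,\mathbf q)=\sum_{i,j}p_iq_j\,r(i,j)$ and $\widetilde H(\mathbf q)=\bigl(\sum_{j}q_jH(i,j)\bigr)_{i\in\mathcal I}\in\Delta(\mathcal H)^{\mathcal I}\subset\mathbb R^{\mathcal I\times\mathcal H}$, let $\mathcal F=\{\widetilde H(\mathbf q):\mathbf q\in\Delta(\mathcal J)\}$, and for $\sigma\in\mathcal F$ let $$\overline m(\mathbf p,\sigma)=\bigl\{r(\mathbf p,\mathbf q'):\ \mathbf q'\in\Delta(\mathcal J),\ \widetilde H(\mathbf q')=\sigma\bigr\}\subset\mathbb R^d .$$ For any such game there exist a finite set $\mathcal B\subset\mathcal F$ and an injective piecewise-linear map $\Phi=(\Phi_b)_{b\in\mathcal B}:\mathcal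 F\to\Delta(\mathcal B)$ (that is, $\mathcal F$ is a union of finitely many polytopes, on each of which $\Phi$ coincides with an affine map) such that $$\overline m(\mathbf p,\sigma)=\sum_{b\in\mathcal B}\Phi_b(\sigma)\,\overline m(\mathbf p,b)\qquad\text{for all }\mathbf p\in\Delta(\mathcal I)\text{ and }\sigma\in\mathcal F,$$ where the right-hand side is the Minkowski combination of sets $\bigl\{\sum_b\Phi_b(\sigma)x_b:\ x_b\in\overline m(\mathbf p,b)\text{ for all }b\bigr\}$. Moreover, $\Phi$ is Lipschitz on $\mathcal F$ with respect to the $\ell^2$-norms on $\mathbb R^{\mathcal I\times\mathcal H}$ and $\mathbb R^{\mathcal B}$. -/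

import Mathlib

open scoped Pointwise NNReal

/-- A finite vector-valued game with partial monitoring: action sets `I` (first player) and
`J` (second player), signal set `S`, payoffs `r i j` in Euclidean `ℝ^d`, and laws `H i j` of the
signal, which are probability distributions over `S`. -/
structure PartialMonitoringGame (I J S : Type*) [Fintype S] (d : ℕ) where
  /-- The vector-valued payoff function. -/
  r : I → J → EuclideanSpace ℝ (Fin d)
  /-- The signaling structure. -/
  H : I → J → stdSimplex ℝ S

namespace PartialMonitoringGame

variable {I J S : Type*} [Fintype I] [Fintype J] [Fintype S] {d : ℕ}

/-- The multilinear extension `r(p, q)` of the payoff function to mixed actions. -/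
noncomputable def payoff (G : PartialMonitoringGame I J S d)
    (p : stdSimplex ℝ I) (q : stdSimplex ℝ J) : EuclideanSpace ℝ (Fin d) :=
  ∑ i, ∑ j, ((p : I → ℝ) i * (q : J → ℝ) j) • G.r i j

/-- The vector `H̃(q)` of signal laws: its component of index `i` is the distribution
`∑ j, q j • H i j` over `S`. It is seen as an element of `ℝ^(I × S)` with the `ℓ²` norm. -/
noncomputable def signalMap (G : PartialMonitoringGame I J S d)
    (q : stdSimplex ℝ J) : EuclideanSpace ℝ (I × S) :=
  WithLp.toLp 2 fun x => ∑ j, (q : J → ℝ) j * (G.H x.1 j : S → ℝ) x.2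

/-- The set `F` of feasible vectors of signal laws. -/
def feasible (G : PartialMonitoringGame I J S d) : Set (EuclideanSpace ℝ (I × S)) :=
  Set.range G.signalMap

/-- The set-valued payoff `m̄(p, σ)`: all payoffs compatible with `p` and the signal laws `σ`. -/
def setPayoff (G : PartialMonitoringGame I J S d)
    (p : stdSimplex ℝ I) (σ : EuclideanSpace ℝ (I × S)) : Set (EuclideanSpace ℝ (Fin d)) :=
  {x | ∃ q : stdSimplex ℝ J, G.signalMap q = σ ∧ x = G.payoff p q}

end PartialMonitoringGame

/-- A polytope: the convex hull of a finite set of points. -/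
def IsPolytope {E : Type*} [AddCommGroup E] [Module ℝ E] (P : Set E) : Prop :=
  ∃ V : Set E, V.Finite ∧ P = convexHull ℝ V

/-- A map defined on `X` is piecewise linear if `X` is a union of finitely many polytopes, on each
of which the map coincides with an affine map, i.e. respects convex combinations. (Since
finitely many polytopes have a common polyhedral refinement, it does not matter whether they are
allowed to overlap.) -/
def IsPiecewiseLinear {E V : Type*} [AddCommGroup E] [Module ℝ E] [AddCommGroup V] [Module ℝ V]
    {X : Set E} (f : X → V) : Prop :=
  ∃ D : Set (Set E), D.Finite ∧ (∀ P ∈ D, IsPolytope P) ∧ ⋃₀ D = X ∧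
    ∀ P ∈ D, ∃ A : E →ᵃ[ℝ] V, ∀ x : X, (x : E) ∈ P → f x = A x

/-!
The set `F` is the image of a standard simplex under a linear map `T`, with vertices
`v j = T (e j)`. The payoff sets are linear images of the fibres of `T`, so it suffices to
triangulate `F` in such a way that, with `Φ σ` the barycentric coordinates of `σ` in the simplex
containing it, the fibre over `σ` is the combination with weights `Φ σ` of the fibres over the
vertices of the triangulation.

An extreme point `q` of the fibre over `σ` has a support on which the `v j` are affinely
independent, so it is the value at `σ` of an affine section of `T` over the simplex spanned by these
`v j`. If the simplex of the triangulation containing `σ` lies inside that one, evaluating the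
section at its vertices exhibits `q` in the combination of fibres, and the theorem of Krein and
Milman gives the rest of the fibre. It remains to find a triangulation for which every simplex with
affinely independent vertices among the `v j` is a union of simplices. Such a simplex is a finite
intersection of halfspaces, so one starts from a single large simplex and subdivides every edge
which crosses one of the finitely many bounding hyperplanes, at the crossing point. Subdividing
changes barycentric coordinates only through the minimum of two of them, up to constant factors,
and therefore keeps them Lipschitz.
-/

section Weights

variable {E W : Type*} [AddCommGroup E] [Module ℝ E] [AddCommGroup W] [Module ℝ W]

/-- The total moment `∑ w b • b` and the total mass `∑ w b` of a finitely supported weight `w`.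
The kernel consists of the affine dependencies between points of `E`. -/
noncomputable def homogenize : (E →₀ ℝ) →ₗ[ℝ] E × ℝ :=
  Finsupp.linearCombination ℝ fun b => (b, 1)

@[simp]
theorem homogenize_single (b : E) (t : ℝ) : homogenize (Finsupp.single b t) = (t • b, t) := by
  simp [homogenize]

theorem homogenize_eq_sum {w : E →₀ ℝ} {B : Finset E} (hB : w.support ⊆ B) :
    homogenize w = ∑ b ∈ B, w b • (b, (1 : ℝ)) := by
  rw [homogenize, Finsupp.linearCombination_apply]
  exact Finsupp.sum_of_support_subset _ hB _ (by simp)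

/-- The weight `w` is a finitely supported probability on `E` with barycenter `y`. -/
structure HasBarycenter (w : E →₀ ℝ) (y : E) : Prop where
  nonneg : ∀ x, 0 ≤ w x
  homogenize_eq : homogenize w = (y, 1)

theorem hasBarycenter_single (y : E) : HasBarycenter (Finsupp.single y 1) y where
  nonneg := Finsupp.single_nonneg.2 zero_le_one
  homogenize_eq := by simp

namespace HasBarycenter

variable {w w' : E →₀ ℝ} {y y' : E} {B : Finset E}

theorem convexCombination (hw : HasBarycenter w y) (hw' : HasBarycenter w' y') {α β : ℝ}
    (hα : 0 ≤ α) (hβ : 0 ≤ β) (hαβ : α + β = 1) :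
    HasBarycenter (α • w + β • w') (α • y + β • y') where
  nonneg x := add_nonneg (mul_nonneg hα (hw.nonneg x)) (mul_nonneg hβ (hw'.nonneg x))
  homogenize_eq := by simp [hw.homogenize_eq, hw'.homogenize_eq, hαβ]

theorem add_ker (hw : HasBarycenter w y) {ρ : E →₀ ℝ} (hρ : homogenize ρ = 0)
    (h : ∀ x, 0 ≤ (w + ρ) x) : HasBarycenter (w + ρ) y where
  nonneg := h
  homogenize_eq := by rw [map_add, hw.homogenize_eq, hρ, add_zero]

theorem sum_eq_one (hw : HasBarycenter w y) (hB : w.support ⊆ B) : ∑ b ∈ B, w b = 1 := by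
  simpa [homogenize_eq_sum hB, Prod.snd_sum] using congrArg Prod.snd hw.homogenize_eq

theorem sum_smul_eq (hw : HasBarycenter w y) (hB : w.support ⊆ B) : ∑ b ∈ B, w b • b = y := by
  simpa [homogenize_eq_sum hB, Prod.fst_sum] using congrArg Prod.fst hw.homogenize_eq

theorem sum_smul_affineMap (hw : HasBarycenter w y) (hB : w.support ⊆ B) (f : E →ᵃ[ℝ] W) :
    ∑ b ∈ B, w b • f b = f y := by
  have hf : ∀ x, f x = f.linear x + f 0 := congrFun f.decomp
  calc ∑ b ∈ B, w b • f b = f.linear (∑ b ∈ B, w b • b) + (∑ b ∈ B, w b) • f 0 := by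
        simp only [map_sum, map_smul, Finset.sum_smul, ← Finset.sum_add_distrib, ← smul_add, ← hf]
    _ = f y := by rw [hw.sum_smul_eq hB, hw.sum_eq_one hB, one_smul, ← hf]

theorem mem_convexHull (hw : HasBarycenter w y) : y ∈ convexHull ℝ (w.support : Set E) :=
  Finset.mem_convexHull'.2
    ⟨w, fun x _ => hw.nonneg x, hw.sum_eq_one subset_rfl, hw.sum_smul_eq subset_rfl⟩

end HasBarycenter

theorem exists_hasBarycenter_of_mem_convexHull {s : Set E} {y : E} (hy : y ∈ convexHull ℝ s) :
    ∃ w : E →₀ ℝ, HasBarycenter w y ∧ (w.support : Set E) ⊆ s := by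
  classical
  have hconvex : Convex ℝ {y | ∃ w : E →₀ ℝ, HasBarycenter w y ∧ (w.support : Set E) ⊆ s} := by
    rintro y ⟨w, hw, hws⟩ y' ⟨w', hw', hws'⟩ α β hα hβ hαβ
    refine ⟨_, hw.convexCombination hw' hα hβ hαβ, fun x hx => ?_⟩
    rcases Finset.mem_union.1 (Finsupp.support_add hx) with hx | hx
    · exact hws (Finsupp.support_smul hx)
    · exact hws' (Finsupp.support_smul hx)
  refine convexHull_min (fun x hx => ?_) hconvex hy
  exact ⟨Finsupp.single x 1, hasBarycenter_single x, fun z hz =>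
    Finset.mem_singleton.1 (Finsupp.support_single_subset hz) ▸ hx⟩

theorem exists_pos_forall_mul_abs_le {ι : Type*} {s : Finset ι} {w : ι → ℝ}
    (hw : ∀ i ∈ s, 0 < w i) (z : ι → ℝ) : ∃ t > 0, ∀ i ∈ s, t * |z i| ≤ w i := by
  have small : ∀ i ∈ s, ∀ᶠ t in nhdsWithin (0 : ℝ) (Set.Ioi 0), t * |z i| < w i := fun i hi =>
    ((continuous_mul_const |z i|).tendsto' 0 0 (zero_mul _)).eventually_lt_const (hw i hi)
      |>.filter_mono nhdsWithin_le_nhds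
  obtain ⟨t, hle, ht⟩ := (((Filter.eventually_all_finset s).2 small).and
    self_mem_nhdsWithin).exists
  exact ⟨t, ht, fun i hi => (hle i hi).le⟩

end Weights

section EdgeSubdivision

variable {E : Type*} [AddCommGroup E] [Module ℝ E] {a b : E} {t : ℝ}

/-- The affine dependency between the ends `a`, `b` of an edge and its point
`AffineMap.lineMap a b t = (1 - t) • a + t • b`. -/
noncomputable def edgeRelation (a b : E) (t : ℝ) : E →₀ ℝ :=
  Finsupp.single (AffineMap.lineMap a b t) 1 - Finsupp.single a (1 - t) - Finsupp.single b t

@[simp]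
theorem homogenize_edgeRelation (a b : E) (t : ℝ) : homogenize (edgeRelation a b t) = 0 := by
  simp [edgeRelation, AffineMap.lineMap_apply_module, sub_smul]

theorem lineMap_ne_left (hab : a ≠ b) (ht : 0 < t) : AffineMap.lineMap a b t ≠ a := by
  simp [AffineMap.lineMap_eq_left_iff, hab, ht.ne']

theorem lineMap_ne_right (hab : a ≠ b) (ht : t < 1) : AffineMap.lineMap a b t ≠ b := by
  simp [AffineMap.lineMap_eq_right_iff, hab, ht.ne]

theorem edgeRelation_apply_left (hab : a ≠ b) (ht : 0 < t) :
    edgeRelation a b t a = -(1 - t) := by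
  simp [edgeRelation, hab, lineMap_ne_left hab ht]

theorem edgeRelation_apply_right (hab : a ≠ b) (ht : t < 1) : edgeRelation a b t b = -t := by
  simp [edgeRelation, hab.symm, lineMap_ne_right hab ht]

theorem edgeRelation_apply_lineMap (hab : a ≠ b) (ht : t ∈ Set.Ioo 0 1) :
    edgeRelation a b t (AffineMap.lineMap a b t) = 1 := by
  simp [edgeRelation, lineMap_ne_left hab ht.1, lineMap_ne_right hab ht.2]

theorem edgeRelation_apply_of_ne {x : E} (ha : x ≠ a) (hb : x ≠ b)
    (hc : x ≠ AffineMap.lineMap a b t) : edgeRelation a b t x = 0 := by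
  simp [edgeRelation, ha, hb, hc]

/-- The effect on barycentric coordinates of subdividing the edge `[a, b]` at
`AffineMap.lineMap a b t`: the largest possible mass is moved from `a` and `b` to that point. -/
noncomputable def edgeSplit (a b : E) (t : ℝ) (w : E →₀ ℝ) : E →₀ ℝ :=
  w + min (w a / (1 - t)) (w b / t) • edgeRelation a b t

/-- The effect on barycentric coordinates of removing the vertex `AffineMap.lineMap a b t`: its
mass is given back to `a` and `b`. -/
noncomputable def edgeMerge (a b : E) (t : ℝ) (w : E →₀ ℝ) : E →₀ ℝ :=
  w - w (AffineMap.lineMap a b t) • edgeRelation a b t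

theorem edgeSplit_apply_left (hab : a ≠ b) (ht : t ∈ Set.Ioo 0 1) (w : E →₀ ℝ) :
    edgeSplit a b t w a = w a - min (w a / (1 - t)) (w b / t) * (1 - t) := by
  simp only [edgeSplit, Finsupp.add_apply, Finsupp.smul_apply, smul_eq_mul,
    edgeRelation_apply_left hab ht.1]
  ring

theorem edgeSplit_apply_right (hab : a ≠ b) (ht : t ∈ Set.Ioo 0 1) (w : E →₀ ℝ) :
    edgeSplit a b t w b = w b - min (w a / (1 - t)) (w b / t) * t := by
  simp only [edgeSplit, Finsupp.add_apply, Finsupp.smul_apply, smul_eq_mul,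
    edgeRelation_apply_right hab ht.2]
  ring

theorem edgeSplit_apply_lineMap (hab : a ≠ b) (ht : t ∈ Set.Ioo 0 1) (w : E →₀ ℝ) :
    edgeSplit a b t w (AffineMap.lineMap a b t) =
      w (AffineMap.lineMap a b t) + min (w a / (1 - t)) (w b / t) := by
  simp [edgeSplit, edgeRelation_apply_lineMap hab ht]

theorem edgeSplit_apply_of_ne {x : E} (ha : x ≠ a) (hb : x ≠ b)
    (hc : x ≠ AffineMap.lineMap a b t) (w : E →₀ ℝ) : edgeSplit a b t w x = w x := by
  simp [edgeSplit, edgeRelation_apply_of_ne ha hb hc]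

theorem edgeSplit_left_or_right_eq_zero (hab : a ≠ b) (ht : t ∈ Set.Ioo 0 1) (w : E →₀ ℝ) :
    edgeSplit a b t w a = 0 ∨ edgeSplit a b t w b = 0 := by
  rw [edgeSplit_apply_left hab ht, edgeSplit_apply_right hab ht]
  refine (min_choice (w a / (1 - t)) (w b / t)).imp (fun h => ?_) fun h => ?_
  · rw [h, div_mul_cancel₀ _ (sub_pos.2 ht.2).ne', sub_self]
  · rw [h, div_mul_cancel₀ _ ht.1.ne', sub_self]

theorem edgeSplit_nonneg (hab : a ≠ b) (ht : t ∈ Set.Ioo 0 1) {w : E →₀ ℝ}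
    (hw : ∀ x, 0 ≤ w x) (x : E) : 0 ≤ edgeSplit a b t w x := by
  have ht' : 0 < 1 - t := sub_pos.2 ht.2
  by_cases ha : x = a
  · rw [ha, edgeSplit_apply_left hab ht, sub_nonneg, ← le_div_iff₀ ht']
    exact min_le_left _ _
  by_cases hb : x = b
  · rw [hb, edgeSplit_apply_right hab ht, sub_nonneg, ← le_div_iff₀ ht.1]
    exact min_le_right _ _
  by_cases hc : x = AffineMap.lineMap a b t
  · rw [hc, edgeSplit_apply_lineMap hab ht]
    exact add_nonneg (hw _) (le_min (div_nonneg (hw a) ht'.le) (div_nonneg (hw b) ht.1.le))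
  · rw [edgeSplit_apply_of_ne ha hb hc]
    exact hw x

theorem edgeSplit_eq_self (ht : t ∈ Set.Ioo 0 1) {w : E →₀ ℝ} (hw : ∀ x, 0 ≤ w x)
    (h : w a = 0 ∨ w b = 0) : edgeSplit a b t w = w := by
  have ht' : 0 < 1 - t := sub_pos.2 ht.2
  have hmin : min (w a / (1 - t)) (w b / t) = 0 := by
    rcases h with h | h
    · rw [h, zero_div, min_eq_left (div_nonneg (hw b) ht.1.le)]
    · rw [h, zero_div, min_eq_right (div_nonneg (hw a) ht'.le)]
  rw [edgeSplit, hmin, zero_smul, add_zero]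

theorem ne_zero_of_edgeSplit_ne_zero (ht : t ∈ Set.Ioo 0 1) {w : E →₀ ℝ} (hw : ∀ x, 0 ≤ w x)
    {x : E} (hx : edgeSplit a b t w x ≠ 0) :
    w x ≠ 0 ∨ x = AffineMap.lineMap a b t ∧ w a ≠ 0 ∧ w b ≠ 0 := by
  by_cases hab : w a = 0 ∨ w b = 0
  · exact Or.inl (edgeSplit_eq_self ht hw hab ▸ hx)
  rw [not_or] at hab
  by_cases hc : x = AffineMap.lineMap a b t
  · exact Or.inr ⟨hc, hab⟩
  left
  by_cases ha : x = a
  · exact ha ▸ hab.1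
  by_cases hb : x = b
  · exact hb ▸ hab.2
  rwa [edgeSplit_apply_of_ne ha hb hc] at hx

theorem support_edgeSplit_subset_convexHull (ht : t ∈ Set.Ioo 0 1) {w : E →₀ ℝ}
    (hw : ∀ x, 0 ≤ w x) :
    ((edgeSplit a b t w).support : Set E) ⊆ convexHull ℝ (w.support : Set E) := by
  intro x hx
  rcases ne_zero_of_edgeSplit_ne_zero ht hw (Finsupp.mem_support_iff.1 hx) with hx | ⟨rfl, ha, hb⟩
  · exact subset_convexHull ℝ _ (Finsupp.mem_support_iff.2 hx)
  · exact (convex_convexHull ℝ _).lineMap_mem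
      (subset_convexHull ℝ _ (Finsupp.mem_support_iff.2 ha))
      (subset_convexHull ℝ _ (Finsupp.mem_support_iff.2 hb)) (Set.Ioo_subset_Icc_self ht)

theorem HasBarycenter.edgeSplit (hab : a ≠ b) (ht : t ∈ Set.Ioo 0 1) {w : E →₀ ℝ} {y : E}
    (hw : HasBarycenter w y) : HasBarycenter (edgeSplit a b t w) y :=
  hw.add_ker (by simp) (edgeSplit_nonneg hab ht hw.nonneg)

theorem edgeMerge_apply_left (hab : a ≠ b) (ht : t ∈ Set.Ioo 0 1) (w : E →₀ ℝ) :
    edgeMerge a b t w a = w a + w (AffineMap.lineMap a b t) * (1 - t) := by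
  simp only [edgeMerge, Finsupp.sub_apply, Finsupp.smul_apply, smul_eq_mul,
    edgeRelation_apply_left hab ht.1]
  ring

theorem edgeMerge_apply_right (hab : a ≠ b) (ht : t ∈ Set.Ioo 0 1) (w : E →₀ ℝ) :
    edgeMerge a b t w b = w b + w (AffineMap.lineMap a b t) * t := by
  simp only [edgeMerge, Finsupp.sub_apply, Finsupp.smul_apply, smul_eq_mul,
    edgeRelation_apply_right hab ht.2]
  ring

theorem edgeMerge_apply_lineMap (hab : a ≠ b) (ht : t ∈ Set.Ioo 0 1) (w : E →₀ ℝ) :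
    edgeMerge a b t w (AffineMap.lineMap a b t) = 0 := by
  simp [edgeMerge, edgeRelation_apply_lineMap hab ht]

theorem edgeMerge_apply_of_ne {x : E} (ha : x ≠ a) (hb : x ≠ b)
    (hc : x ≠ AffineMap.lineMap a b t) (w : E →₀ ℝ) : edgeMerge a b t w x = w x := by
  simp [edgeMerge, edgeRelation_apply_of_ne ha hb hc]

theorem edgeMerge_nonneg (hab : a ≠ b) (ht : t ∈ Set.Ioo 0 1) {w : E →₀ ℝ}
    (hw : ∀ x, 0 ≤ w x) (x : E) : 0 ≤ edgeMerge a b t w x := by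
  by_cases ha : x = a
  · rw [ha, edgeMerge_apply_left hab ht]
    exact add_nonneg (hw a) (mul_nonneg (hw _) (sub_pos.2 ht.2).le)
  by_cases hb : x = b
  · rw [hb, edgeMerge_apply_right hab ht]
    exact add_nonneg (hw b) (mul_nonneg (hw _) ht.1.le)
  by_cases hc : x = AffineMap.lineMap a b t
  · rw [hc, edgeMerge_apply_lineMap hab ht]
  · rw [edgeMerge_apply_of_ne ha hb hc]
    exact hw x

theorem HasBarycenter.edgeMerge (hab : a ≠ b) (ht : t ∈ Set.Ioo 0 1) {w : E →₀ ℝ} {y : E}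
    (hw : HasBarycenter w y) : HasBarycenter (edgeMerge a b t w) y := by
  have hnonneg := edgeMerge_nonneg hab ht hw.nonneg
  rw [_root_.edgeMerge, sub_eq_add_neg] at hnonneg ⊢
  exact hw.add_ker (by simp) hnonneg

theorem edgeSplit_edgeMerge (hab : a ≠ b) (ht : t ∈ Set.Ioo 0 1) {w : E →₀ ℝ}
    (hw : ∀ x, 0 ≤ w x) (h : w a = 0 ∨ w b = 0) :
    edgeSplit a b t (edgeMerge a b t w) = w := by
  have ht' : 0 < 1 - t := sub_pos.2 ht.2
  have hmin : min (edgeMerge a b t w a / (1 - t)) (edgeMerge a b t w b / t) =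
      w (AffineMap.lineMap a b t) := by
    rw [edgeMerge_apply_left hab ht, edgeMerge_apply_right hab ht, add_div, add_div,
      mul_div_cancel_right₀ _ ht'.ne', mul_div_cancel_right₀ _ ht.1.ne', min_add_add_right]
    rcases h with h | h
    · rw [h, zero_div, min_eq_left (div_nonneg (hw b) ht.1.le), zero_add]
    · rw [h, zero_div, min_eq_right (div_nonneg (hw a) ht'.le), zero_add]
  rw [edgeSplit, hmin, edgeMerge, sub_add_cancel]

theorem support_edgeMerge_subset (hab : a ≠ b) (ht : t ∈ Set.Ioo 0 1) {u w : E →₀ ℝ}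
    (hu : ∀ x, 0 ≤ u x) (huc : u (AffineMap.lineMap a b t) = 0)
    (hw : w.support ⊆ (edgeSplit a b t u).support) : (edgeMerge a b t w).support ⊆ u.support := by
  intro x hx
  rw [Finsupp.mem_support_iff] at hx ⊢
  have hsplit : ∀ z, w z ≠ 0 → u z ≠ 0 ∨ z = AffineMap.lineMap a b t ∧ u a ≠ 0 ∧ u b ≠ 0 :=
    fun z hz => ne_zero_of_edgeSplit_ne_zero ht hu
      (Finsupp.mem_support_iff.1 (hw (Finsupp.mem_support_iff.2 hz)))
  have hxc : x ≠ AffineMap.lineMap a b t := fun h =>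
    hx (h ▸ edgeMerge_apply_lineMap hab ht w)
  by_cases hwx : w x = 0
  · by_cases hwc : w (AffineMap.lineMap a b t) = 0
    · simp [edgeMerge, hwc, hwx] at hx
    obtain ⟨-, ha, hb⟩ := (hsplit _ hwc).resolve_left (not_not.2 huc)
    by_cases hxa : x = a
    · exact hxa ▸ ha
    by_cases hxb : x = b
    · exact hxb ▸ hb
    rw [edgeMerge_apply_of_ne hxa hxb hxc] at hx
    exact absurd hwx hx
  · exact (hsplit x hwx).resolve_right fun h => hxc h.1

end EdgeSubdivision

section Subcomplex

variable {E : Type*} {Ω : Set E} {Φ : E → E →₀ ℝ}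

/-- The simplex whose relative interior contains a given point of `P` has its vertices in `P`. If
`P` is convex, this means that `Ω ∩ P` is a union of simplices `conv (Φ σ).support`. -/
def IsSubcomplex (Ω : Set E) (Φ : E → E →₀ ℝ) (P : Set E) : Prop :=
  ∀ σ ∈ Ω, σ ∈ P → ((Φ σ).support : Set E) ⊆ P

theorem IsSubcomplex.biInter {ι : Type*} {s : Set ι} {P : ι → Set E}
    (hP : ∀ i ∈ s, IsSubcomplex Ω Φ (P i)) : IsSubcomplex Ω Φ (⋂ i ∈ s, P i) :=
  fun σ hσ hσP => Set.subset_iInter₂ fun i hi => hP i hi σ hσ (Set.mem_iInter₂.1 hσP i hi)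

variable [AddCommGroup E] [Module ℝ E] {f : E →ᵃ[ℝ] ℝ} {a b : E}

/-- No simplex `conv (Φ σ).support` with `σ ∈ Ω` crosses the hyperplane `f = 0`. -/
def IsSignCompatible (Ω : Set E) (Φ : E → E →₀ ℝ) (f : E →ᵃ[ℝ] ℝ) : Prop :=
  ∀ σ ∈ Ω, (∀ b ∈ (Φ σ).support, 0 ≤ f b) ∨ ∀ b ∈ (Φ σ).support, f b ≤ 0

/-- The edges of a triangulation which cross the hyperplane `f = 0`, oriented along `f`. -/
def crossingPairs (Ω : Set E) (Φ : E → E →₀ ℝ) (f : E →ᵃ[ℝ] ℝ) : Set (E × E) :=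
  {p | f p.1 < 0 ∧ 0 < f p.2 ∧ ∃ σ ∈ Ω, Φ σ p.1 ≠ 0 ∧ Φ σ p.2 ≠ 0}

theorem isSignCompatible_of_crossingPairs_eq_empty (h : crossingPairs Ω Φ f = ∅) :
    IsSignCompatible Ω Φ f := by
  intro σ hσ
  by_contra! hcross
  obtain ⟨⟨a, ha, hfa⟩, b, hb, hfb⟩ := hcross
  exact Set.notMem_empty (a, b) <| h ▸
    ⟨hfa, hfb, σ, hσ, Finsupp.mem_support_iff.1 ha, Finsupp.mem_support_iff.1 hb⟩

theorem exists_lineMap_eq_zero (ha : f a < 0) (hb : 0 < f b) :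
    ∃ t ∈ Set.Ioo (0 : ℝ) 1, f (AffineMap.lineMap a b t) = 0 := by
  have hpos : 0 < f b - f a := by linarith
  refine ⟨-f a / (f b - f a), ⟨div_pos (neg_pos.2 ha) hpos, (div_lt_one hpos).2 (by linarith)⟩, ?_⟩
  rw [f.apply_lineMap, AffineMap.lineMap_apply_module, smul_eq_mul, smul_eq_mul]
  field_simp
  ring

end Subcomplex

section Triangulation

variable {E : Type*} [NormedAddCommGroup E] [NormedSpace ℝ E]
  {Ω : Set E} {B : Finset E} {Φ : E → E →₀ ℝ} {f : E →ᵃ[ℝ] ℝ} {a b σ : E} {t : ℝ}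

/-- The weights `Φ σ`, for `σ` in `Ω`, are the barycentric coordinates of `σ` in a triangulation
of `Ω` with vertices in `B`. The simplices are not recorded: they are the convex hulls of the
supports of the weights `Φ σ`, and every weight carried by such a support is the one which `Φ`
assigns to its barycenter. -/
structure IsTriangulation (Ω : Set E) (B : Finset E) (Φ : E → E →₀ ℝ) : Prop where
  hasBarycenter : ∀ σ ∈ Ω, HasBarycenter (Φ σ) σ
  support_subset : ∀ σ ∈ Ω, (Φ σ).support ⊆ B
  eq_of_support_subset : ∀ σ ∈ Ω, ∀ w y, HasBarycenter w y → w.support ⊆ (Φ σ).support → Φ y = w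
  lipschitz : ∀ b, ∃ K : ℝ≥0, LipschitzOnWith K (fun σ => Φ σ b) Ω

theorem IsTriangulation.mono {Ω' : Set E} (hΦ : IsTriangulation Ω B Φ) (h : Ω' ⊆ Ω) :
    IsTriangulation Ω' B Φ where
  hasBarycenter σ hσ := hΦ.hasBarycenter σ (h hσ)
  support_subset σ hσ := hΦ.support_subset σ (h hσ)
  eq_of_support_subset σ hσ := hΦ.eq_of_support_subset σ (h hσ)
  lipschitz b := (hΦ.lipschitz b).imp fun _ hK => hK.mono h

theorem IsTriangulation.apply_lineMap_eq_zero (hΦ : IsTriangulation Ω B Φ) (hab : a ≠ b)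
    (ht : t ∈ Set.Ioo 0 1) (hedge : ∃ τ ∈ Ω, Φ τ a ≠ 0 ∧ Φ τ b ≠ 0) (hσ : σ ∈ Ω) :
    Φ σ (AffineMap.lineMap a b t) = 0 := by
  classical
  obtain ⟨τ, hτ, ha, hb⟩ := hedge
  by_contra hne
  have hvertex : Φ (AffineMap.lineMap a b t) = Finsupp.single (AffineMap.lineMap a b t) 1 :=
    hΦ.eq_of_support_subset σ hσ _ _ (hasBarycenter_single _) fun x hx =>
      Finset.mem_singleton.1 (Finsupp.support_single_subset hx) ▸ Finsupp.mem_support_iff.2 hne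
  have hmid : Φ (AffineMap.lineMap a b t) =
      (1 - t) • Finsupp.single a 1 + t • Finsupp.single b 1 := by
    refine hΦ.eq_of_support_subset τ hτ _ _ ?_ fun x hx => ?_
    · rw [AffineMap.lineMap_apply_module]
      exact (hasBarycenter_single a).convexCombination (hasBarycenter_single b)
        (sub_pos.2 ht.2).le ht.1.le (sub_add_cancel 1 t)
    · rw [Finsupp.mem_support_iff]
      rintro h0
      have hax : a ≠ x := fun h => ha (h ▸ h0)
      have hbx : b ≠ x := fun h => hb (h ▸ h0)
      simp [hax.symm, hbx.symm] at hx
  have hcoord := DFunLike.congr_fun (hvertex.symm.trans hmid) a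
  simp [lineMap_ne_left hab ht.1, hab, (sub_pos.2 ht.2).ne] at hcoord

theorem exists_lipschitzOnWith_edgeSplit (h : ∀ b, ∃ K : ℝ≥0, LipschitzOnWith K (fun σ => Φ σ b) Ω)
    (a b : E) (t : ℝ) (x : E) :
    ∃ K : ℝ≥0, LipschitzOnWith K (fun σ => edgeSplit a b t (Φ σ) x) Ω := by
  simp only [lipschitzOnWith_iff_restrict] at h ⊢
  obtain ⟨Kx, hx⟩ := h x
  obtain ⟨Ka, ha⟩ := h a
  obtain ⟨Kb, hb⟩ := h b
  have hmin := ((lipschitzWith_smul (1 - t)⁻¹).comp ha).min ((lipschitzWith_smul t⁻¹).comp hb)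
  have hsplit (w : E →₀ ℝ) : edgeSplit a b t w x =
      w x + edgeRelation a b t x • min ((1 - t)⁻¹ • w a) (t⁻¹ • w b) := by
    simp [edgeSplit, div_eq_inv_mul, mul_comm]
  simp only [hsplit]
  exact ⟨_, hx.add ((lipschitzWith_smul (edgeRelation a b t x)).comp hmin)⟩

theorem IsTriangulation.edgeSplit [DecidableEq E] (hΦ : IsTriangulation Ω B Φ) (hab : a ≠ b)
    (ht : t ∈ Set.Ioo 0 1) (hedge : ∃ τ ∈ Ω, Φ τ a ≠ 0 ∧ Φ τ b ≠ 0) :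
    IsTriangulation Ω (insert (AffineMap.lineMap a b t) B) fun σ => edgeSplit a b t (Φ σ) where
  hasBarycenter σ hσ := (hΦ.hasBarycenter σ hσ).edgeSplit hab ht
  support_subset σ hσ x hx := by
    rcases ne_zero_of_edgeSplit_ne_zero ht (hΦ.hasBarycenter σ hσ).nonneg
      (Finsupp.mem_support_iff.1 hx) with hx | ⟨rfl, -⟩
    · exact Finset.mem_insert_of_mem (hΦ.support_subset σ hσ (Finsupp.mem_support_iff.2 hx))
    · exact Finset.mem_insert_self _ _
  eq_of_support_subset σ hσ w y hw hsupp := by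
    have hend : w a = 0 ∨ w b = 0 :=
      (edgeSplit_left_or_right_eq_zero hab ht (Φ σ)).imp
        (fun h => by_contra fun hne => Finsupp.mem_support_iff.1
          (hsupp (Finsupp.mem_support_iff.2 hne)) h)
        (fun h => by_contra fun hne => Finsupp.mem_support_iff.1
          (hsupp (Finsupp.mem_support_iff.2 hne)) h)
    have hmerge : Φ y = edgeMerge a b t w :=
      hΦ.eq_of_support_subset σ hσ _ y (hw.edgeMerge hab ht) <|
        support_edgeMerge_subset hab ht (hΦ.hasBarycenter σ hσ).nonneg
          (hΦ.apply_lineMap_eq_zero hab ht hedge hσ) hsupp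
    rw [hmerge, edgeSplit_edgeMerge hab ht hw.nonneg hend]
  lipschitz := exists_lipschitzOnWith_edgeSplit hΦ.lipschitz a b t

theorem IsSignCompatible.edgeSplit (hf : IsSignCompatible Ω Φ f) (hΦ : IsTriangulation Ω B Φ)
    (ht : t ∈ Set.Ioo 0 1) : IsSignCompatible Ω (fun σ => edgeSplit a b t (Φ σ)) f := by
  intro σ hσ
  have hsupp := support_edgeSplit_subset_convexHull (a := a) (b := b) ht
    (hΦ.hasBarycenter σ hσ).nonneg
  exact (hf σ hσ).imp
    (fun h x hx => convexHull_min h ((convex_Ici 0).affine_preimage f) (hsupp hx))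
    (fun h x hx => convexHull_min h ((convex_Iic 0).affine_preimage f) (hsupp hx))

theorem IsTriangulation.finite_crossingPairs (hΦ : IsTriangulation Ω B Φ) (f : E →ᵃ[ℝ] ℝ) :
    (crossingPairs Ω Φ f).Finite := by
  refine (B ×ˢ B).finite_toSet.subset ?_
  rintro p ⟨-, -, σ, hσ, h₁, h₂⟩
  exact Finset.mem_product.2 ⟨hΦ.support_subset σ hσ (Finsupp.mem_support_iff.2 h₁),
    hΦ.support_subset σ hσ (Finsupp.mem_support_iff.2 h₂)⟩

theorem IsTriangulation.crossingPairs_edgeSplit_ssubset (hΦ : IsTriangulation Ω B Φ)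
    (hp : (a, b) ∈ crossingPairs Ω Φ f) (ht : t ∈ Set.Ioo 0 1)
    (hft : f (AffineMap.lineMap a b t) = 0) :
    crossingPairs Ω (fun σ => _root_.edgeSplit a b t (Φ σ)) f ⊂ crossingPairs Ω Φ f := by
  have hab : a ≠ b := by
    rintro rfl
    exact lt_asymm hp.1 hp.2.1
  have hold : ∀ σ ∈ Ω, ∀ x, f x ≠ 0 → _root_.edgeSplit a b t (Φ σ) x ≠ 0 → Φ σ x ≠ 0 :=
    fun σ hσ x hfx hx =>
      (ne_zero_of_edgeSplit_ne_zero ht (hΦ.hasBarycenter σ hσ).nonneg hx).resolve_right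
        fun h => hfx (h.1 ▸ hft)
  refine (Set.ssubset_iff_of_subset ?_).2 ⟨(a, b), hp, ?_⟩
  · rintro p ⟨h₁, h₂, σ, hσ, hσ₁, hσ₂⟩
    exact ⟨h₁, h₂, σ, hσ, hold σ hσ _ h₁.ne hσ₁, hold σ hσ _ h₂.ne' hσ₂⟩
  · rintro ⟨-, -, σ, -, ha, hb⟩
    exact (edgeSplit_left_or_right_eq_zero hab ht (Φ σ)).elim ha hb

theorem IsTriangulation.exists_isSignCompatible_insert (hΦ : IsTriangulation Ω B Φ)
    (f : E →ᵃ[ℝ] ℝ) {F : Set (E →ᵃ[ℝ] ℝ)} (hF : ∀ g ∈ F, IsSignCompatible Ω Φ g) :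
    ∃ B' Φ', IsTriangulation Ω B' Φ' ∧ ∀ g ∈ insert f F, IsSignCompatible Ω Φ' g := by
  classical
  induction hn : (crossingPairs Ω Φ f).ncard using Nat.strong_induction_on generalizing B Φ with
  | _ n ih =>
    rcases (crossingPairs Ω Φ f).eq_empty_or_nonempty with h0 | ⟨⟨a, b⟩, hp⟩
    · exact ⟨B, Φ, hΦ, Set.forall_mem_insert.2 ⟨isSignCompatible_of_crossingPairs_eq_empty h0, hF⟩⟩
    obtain ⟨ha, hb, hedge⟩ := id hp
    have hab : a ≠ b := by
      rintro rfl
      exact lt_asymm ha hb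
    obtain ⟨t, ht, hft⟩ := exists_lineMap_eq_zero ha hb
    have hlt := Set.ncard_lt_ncard (hΦ.crossingPairs_edgeSplit_ssubset hp ht hft)
      (hΦ.finite_crossingPairs f)
    exact ih _ (hn ▸ hlt) (hΦ.edgeSplit hab ht hedge) (fun g hg => (hF g hg).edgeSplit hΦ ht) rfl

theorem IsTriangulation.exists_isSignCompatible (hΦ : IsTriangulation Ω B Φ)
    {F : Set (E →ᵃ[ℝ] ℝ)} (hF : F.Finite) :
    ∃ B' Φ', IsTriangulation Ω B' Φ' ∧ ∀ f ∈ F, IsSignCompatible Ω Φ' f := by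
  induction F, hF using Set.Finite.induction_on with
  | empty => exact ⟨B, Φ, hΦ, by simp⟩
  | @insert f F _ _ ih =>
    obtain ⟨B', Φ', hΦ', hF'⟩ := ih
    exact hΦ'.exists_isSignCompatible_insert f hF'

theorem IsSignCompatible.isSubcomplex (hf : IsSignCompatible Ω Φ f)
    (hΦ : IsTriangulation Ω B Φ) : IsSubcomplex Ω Φ {y | 0 ≤ f y} := by
  intro σ hσ hfσ
  refine (hf σ hσ).elim (fun h => h) fun hneg b hb => ?_
  have hw := hΦ.hasBarycenter σ hσ
  have hterm : ∀ x ∈ (Φ σ).support, Φ σ x • f x ≤ 0 := fun x hx =>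
    mul_nonpos_of_nonneg_of_nonpos (hw.nonneg x) (hneg x hx)
  have hsum : ∑ x ∈ (Φ σ).support, Φ σ x • f x = 0 :=
    le_antisymm (Finset.sum_nonpos hterm) ((hw.sum_smul_affineMap subset_rfl f).symm ▸ hfσ)
  have hzero := (Finset.sum_eq_zero_iff_of_nonpos hterm).1 hsum b hb
  exact ((smul_eq_zero.1 hzero).resolve_left (Finsupp.mem_support_iff.1 hb)).ge

end Triangulation

section AffineBasis

variable {E : Type*} [NormedAddCommGroup E] [NormedSpace ℝ E] {ι : Type*} [Fintype ι]
  (β : AffineBasis ι ℝ E)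

/-- The barycentric coordinates of `y` in the affine basis `β`, as a weight on the points of
`β`. -/
noncomputable def barycentricWeight (y : E) : E →₀ ℝ :=
  ∑ i, Finsupp.single (β i) (β.coord i y)

@[simp]
theorem barycentricWeight_apply_self (y : E) (i : ι) :
    barycentricWeight β y (β i) = β.coord i y := by
  classical
  simp [barycentricWeight, Finsupp.single_apply, β.ind.injective.eq_iff]

theorem barycentricWeight_apply_of_notMem_range (y : E) {x : E} (hx : x ∉ Set.range β) :
    barycentricWeight β y x = 0 := by
  simp only [barycentricWeight, Finsupp.finsetSum_apply]
  exact Finset.sum_eq_zero fun i _ => Finsupp.single_eq_of_ne fun h => hx ⟨i, h.symm⟩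

theorem hasBarycenter_barycentricWeight {y : E} (hy : ∀ i, 0 ≤ β.coord i y) :
    HasBarycenter (barycentricWeight β y) y where
  nonneg := Finsupp.le_def.1 (Finset.sum_nonneg fun i _ => Finsupp.single_nonneg.2 (hy i))
  homogenize_eq := by
    simp [barycentricWeight, ← prod_mk_sum]

theorem HasBarycenter.eq_barycentricWeight {w : E →₀ ℝ} {y : E} (hw : HasBarycenter w y)
    (hsupp : (w.support : Set E) ⊆ Set.range β) : barycentricWeight β y = w := by
  classical
  ext x
  by_cases hx : x ∈ Set.range β
  · obtain ⟨i, rfl⟩ := hx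
    have hB : w.support ⊆ Finset.univ.image β := by simpa [← Finset.coe_subset] using hsupp
    rw [barycentricWeight_apply_self, ← hw.sum_smul_affineMap hB (β.coord i),
      Finset.sum_image β.ind.injective.injOn]
    simp [AffineBasis.coord_apply]
  · rw [barycentricWeight_apply_of_notMem_range β y hx]
    exact (Finsupp.notMem_support_iff.1 fun h => hx (hsupp h)).symm

theorem isTriangulation_barycentricWeight [DecidableEq E] [FiniteDimensional ℝ E] :
    IsTriangulation (convexHull ℝ (Set.range β)) (Finset.univ.image β) (barycentricWeight β) := by
  have hrange (y : E) : ((barycentricWeight β y).support : Set E) ⊆ Set.range β := fun x hx =>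
    by_contra fun h =>
      Finsupp.mem_support_iff.1 hx (barycentricWeight_apply_of_notMem_range β y h)
  refine ⟨fun y hy => ?_, fun y _ => ?_, fun y _ w z hw hsupp => ?_, fun x => ?_⟩
  · rw [β.convexHull_eq_nonneg_coord] at hy
    exact hasBarycenter_barycentricWeight β hy
  · simpa [← Finset.coe_subset] using hrange y
  · exact hw.eq_barycentricWeight β ((Finset.coe_subset.2 hsupp).trans (hrange y))
  · by_cases hx : x ∈ Set.range β
    · obtain ⟨i, rfl⟩ := hx
      obtain ⟨K, hK⟩ := (β.coord i).lipschitzWith_of_finiteDimensional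
      exact ⟨K, by simpa using hK.lipschitzOnWith⟩
    · simp only [barycentricWeight_apply_of_notMem_range β _ hx]
      exact ⟨0, (LipschitzWith.const 0).lipschitzOnWith⟩

end AffineBasis

section FiniteDimensional

variable {E : Type*} [NormedAddCommGroup E] [NormedSpace ℝ E] [FiniteDimensional ℝ E]

theorem exists_affineBasis_subset_convexHull {Ω : Set E} (hΩ : Bornology.IsBounded Ω) :
    ∃ β : AffineBasis (Fin (Module.finrank ℝ E + 1)) ℝ E, Ω ⊆ convexHull ℝ (Set.range β) := by
  obtain ⟨β, hβ, -⟩ :=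
    exists_mem_interior_convexHull_affineBasis (Filter.univ_mem (f := nhds (0 : E)))
  have habs := (NormedSpace.isVonNBounded_iff ℝ).2 hΩ (mem_interior_iff_mem_nhds.1 hβ)
  obtain ⟨c, hsub, hc⟩ := (habs.and (Bornology.eventually_ne_cobounded 0)).exists
  refine ⟨Units.mk0 c hc • β, hsub.trans ?_⟩
  rw [AffineBasis.coe_smul, ← convexHull_smul]
  refine convexHull_mono ?_
  rintro _ ⟨_, ⟨i, rfl⟩, rfl⟩
  exact ⟨i, rfl⟩

/-- Each extension of `s` to an affine basis cuts out the simplex by the conditions that its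
coordinates are nonnegative on `s` and vanish off `s`. -/
theorem exists_finite_halfspaces_convexHull_eq {s : Set E}
    (hs : AffineIndependent ℝ ((↑) : s → E)) :
    ∃ F : Set (E →ᵃ[ℝ] ℝ), F.Finite ∧ convexHull ℝ s = ⋂ f ∈ F, {y | 0 ≤ f y} := by
  classical
  obtain ⟨u, hsu, hu, hspan⟩ := exists_subset_affineIndependent_affineSpan_eq_top hs
  have : Fintype u := (finite_set_of_fin_dim_affineIndependent ℝ hu).fintype
  let β : AffineBasis u ℝ E := ⟨(↑), hu, by rwa [Subtype.range_coe]⟩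
  refine ⟨Set.range β.coord ∪ (fun i => -β.coord i) '' {i | (i : E) ∉ s},
    (Set.finite_range _).union (Set.toFinite _), Set.Subset.antisymm ?_ fun y hy => ?_⟩
  · refine convexHull_min (fun x hx => ?_)
      (convex_iInter₂ fun f _ => (convex_Ici 0).affine_preimage f)
    have hcoord (i : u) : β.coord i x = if i = ⟨x, hsu hx⟩ then 1 else 0 :=
      β.coord_apply i ⟨x, hsu hx⟩
    refine Set.mem_iInter₂.2 ?_
    rintro _ (⟨i, rfl⟩ | ⟨i, hi, rfl⟩)
    · rw [Set.mem_ofPred_eq, hcoord]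
      split_ifs <;> norm_num
    · rw [Set.mem_ofPred_eq, AffineMap.coe_neg, Pi.neg_apply, hcoord,
        if_neg (by rintro rfl; exact hi hx), neg_zero]
  · rw [Set.mem_iInter₂] at hy
    have hnonneg (i : u) : 0 ≤ β.coord i y := hy _ (Or.inl ⟨i, rfl⟩)
    refine convexHull_mono (fun x hx => ?_)
      (hasBarycenter_barycentricWeight β hnonneg).mem_convexHull
    by_contra hxs
    refine Finsupp.mem_support_iff.1 hx ?_
    by_cases hxu : x ∈ u
    · have hnonpos : 0 ≤ -β.coord ⟨x, hxu⟩ y := hy _ (Or.inr ⟨_, hxs, rfl⟩)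
      exact (barycentricWeight_apply_self β y ⟨x, hxu⟩).trans
        (le_antisymm (neg_nonneg.1 hnonpos) (hnonneg _))
    · exact barycentricWeight_apply_of_notMem_range β y fun ⟨i, hi⟩ => hxu (hi ▸ i.2)

theorem IsTriangulation.exists_isSubcomplex_convexHull {Ω : Set E} {B : Finset E}
    {Φ : E → E →₀ ℝ} (hΦ : IsTriangulation Ω B Φ) {S : Set (Set E)} (hS : S.Finite)
    (hind : ∀ s ∈ S, AffineIndependent ℝ ((↑) : s → E)) :
    ∃ B' Φ', IsTriangulation Ω B' Φ' ∧ ∀ s ∈ S, IsSubcomplex Ω Φ' (convexHull ℝ s) := by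
  choose! F hF hFs using fun s hs => exists_finite_halfspaces_convexHull_eq (hind s hs)
  obtain ⟨B', Φ', hΦ', hsign⟩ := hΦ.exists_isSignCompatible (hS.biUnion hF)
  refine ⟨B', Φ', hΦ', fun s hs => ?_⟩
  rw [hFs s hs]
  exact IsSubcomplex.biInter fun f hf =>
    (hsign f (Set.mem_biUnion hs hf)).isSubcomplex hΦ'

theorem exists_isTriangulation_convexHull {V : Set E} (hV : V.Finite) :
    ∃ B Φ, IsTriangulation (convexHull ℝ V) B Φ ∧ (B : Set E) ⊆ convexHull ℝ V ∧
      ∀ s ⊆ V, AffineIndependent ℝ ((↑) : s → E) →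
        IsSubcomplex (convexHull ℝ V) Φ (convexHull ℝ s) := by
  classical
  obtain ⟨β, hβ⟩ := exists_affineBasis_subset_convexHull (isBounded_convexHull.2 hV.isBounded)
  obtain ⟨B, Φ, hΦ, hsub⟩ :=
    ((isTriangulation_barycentricWeight β).mono hβ).exists_isSubcomplex_convexHull
      (hV.finite_subsets.subset (Set.inter_subset_left (t := {s | AffineIndependent ℝ _})))
      fun s hs => hs.2
  have hsupp (σ : E) (hσ : σ ∈ convexHull ℝ V) : ((Φ σ).support : Set E) ⊆ convexHull ℝ V := by
    have hmem := hσ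
    rw [convexHull_eq_union] at hmem
    simp only [Set.mem_iUnion] at hmem
    obtain ⟨s, hsV, hs, hσs⟩ := hmem
    exact (hsub s ⟨hsV, hs⟩ σ hσ hσs).trans (convexHull_mono hsV)
  refine ⟨B.filter (· ∈ convexHull ℝ V), Φ, { hΦ with support_subset := fun σ hσ x hx => ?_ },
    fun x hx => (Finset.mem_filter.1 hx).2, fun s hsV hs => hsub s ⟨hsV, hs⟩⟩
  exact Finset.mem_filter.2 ⟨hΦ.support_subset σ hσ hx, hsupp σ hσ hx⟩

end FiniteDimensional

section AffineInterpolation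

variable {E W ι : Type*} [AddCommGroup E] [Module ℝ E] [AddCommGroup W] [Module ℝ W]

theorem exists_affineMap_apply_eq_of_affineIndependent {p : ι → E}
    (hp : AffineIndependent ℝ p) (v : ι → W) : ∃ A : E →ᵃ[ℝ] W, ∀ i, A (p i) = v i := by
  rcases isEmpty_or_nonempty ι with _ | ⟨⟨i₀⟩⟩
  · exact ⟨0, isEmptyElim⟩
  have hlin := (affineIndependent_iff_linearIndependent_vsub ℝ p i₀).1 hp
  obtain ⟨L, hL⟩ := (Finsupp.linearCombination ℝ fun i : {i // i ≠ i₀} => p i -ᵥ p i₀)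
    |>.exists_leftInverse_of_injective (LinearMap.ker_eq_bot.2 hlin)
  have hcoord (i : {i // i ≠ i₀}) : L (p i -ᵥ p i₀) = Finsupp.single i 1 := by
    simpa using LinearMap.congr_fun hL (Finsupp.single i 1)
  let A : E →ᵃ[ℝ] W := (Finsupp.linearCombination ℝ fun i : {i // i ≠ i₀} => v i - v i₀)
    |>.comp L |>.toAffineMap.comp (AffineMap.id ℝ E -ᵥ AffineMap.const ℝ E (p i₀))
  refine ⟨A + AffineMap.const ℝ E (v i₀), fun i => ?_⟩
  by_cases hi : i = i₀
  · simp [A, hi]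
  · have := hcoord ⟨i, hi⟩
    simp_all [A]

theorem convex_eqLocus_affineMap (f g : E →ᵃ[ℝ] W) : Convex ℝ {x | f x = g x} := by
  simpa [Set.preimage, sub_eq_zero] using (convex_singleton (0 : W)).affine_preimage (f - g)

end AffineInterpolation

namespace IsTriangulation

variable {E : Type*} [NormedAddCommGroup E] [NormedSpace ℝ E]
  {Ω : Set E} {B : Finset E} {Φ : E → E →₀ ℝ} {σ : E}

theorem eq_zero_of_homogenize_eq_zero (hΦ : IsTriangulation Ω B Φ) (hσ : σ ∈ Ω) {ρ : E →₀ ℝ}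
    (hρ : homogenize ρ = 0) (hsupp : ρ.support ⊆ (Φ σ).support) : ρ = 0 := by
  classical
  have hw := hΦ.hasBarycenter σ hσ
  obtain ⟨t, ht, hle⟩ := exists_pos_forall_mul_abs_le (s := (Φ σ).support) (w := Φ σ)
    (fun x hx => (hw.nonneg x).lt_of_ne' (Finsupp.mem_support_iff.1 hx)) ρ
  have hnonneg (x : E) : 0 ≤ (Φ σ + t • ρ) x := by
    by_cases hx : x ∈ (Φ σ).support
    · have habs : t * -|ρ x| ≤ t * ρ x := mul_le_mul_of_nonneg_left (neg_abs_le _) ht.le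
      simp only [Finsupp.add_apply, Finsupp.smul_apply, smul_eq_mul]
      linarith [hle x hx]
    · have hρx : ρ x = 0 := Finsupp.notMem_support_iff.1 fun h => hx (hsupp h)
      simpa [hρx] using hw.nonneg x
  have hperturb : Φ σ = Φ σ + t • ρ :=
    hΦ.eq_of_support_subset σ hσ _ σ (hw.add_ker (by simp [hρ]) hnonneg) <|
      Finsupp.support_add.trans (Finset.union_subset subset_rfl (Finsupp.support_smul.trans hsupp))
  exact (smul_eq_zero.1 (left_eq_add.1 hperturb)).resolve_left ht.ne'

theorem affineIndependent_support (hΦ : IsTriangulation Ω B Φ) (hσ : σ ∈ Ω) :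
    AffineIndependent ℝ ((↑) : (Φ σ).support → E) := by
  classical
  refine affineIndependent_iff.2 fun s w hmass hmoment x hx => ?_
  have hzero : ∑ y ∈ s, Finsupp.single (y : E) (w y) = 0 := by
    refine hΦ.eq_zero_of_homogenize_eq_zero hσ ?_ fun y hy => ?_
    · simp [← prod_mk_sum, hmass, hmoment]
    · obtain ⟨z, -, hz⟩ := Finset.mem_biUnion.1 (Finsupp.support_finsetSum hy)
      exact Finset.mem_singleton.1 (Finsupp.support_single_subset hz) ▸ z.2
  have hx0 := DFunLike.congr_fun hzero (x : E)
  simpa [Finsupp.finsetSum_apply, Finsupp.single_apply, ← Subtype.ext_iff, hx] using hx0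

theorem exists_affineMap_eq_on_convexHull_support (hΦ : IsTriangulation Ω B Φ) (hσ : σ ∈ Ω)
    (C : Set E) : ∃ A : E →ᵃ[ℝ] (C → ℝ),
      ∀ y ∈ convexHull ℝ ((Φ σ).support : Set E), ∀ b : C, Φ y b = A y b := by
  classical
  obtain ⟨A, hA⟩ := exists_affineMap_apply_eq_of_affineIndependent
    (hΦ.affineIndependent_support hσ) fun x (b : C) => if (x : E) = b then (1 : ℝ) else 0
  refine ⟨A, fun y hy b => ?_⟩
  obtain ⟨w, hw, hsupp⟩ := exists_hasBarycenter_of_mem_convexHull hy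
  have hAw : ∀ x ∈ w.support, A x b = if x = b then 1 else 0 := fun x hx =>
    congrFun (hA ⟨x, hsupp hx⟩) b
  calc Φ y b = w b := by rw [hΦ.eq_of_support_subset σ hσ w y hw hsupp]
    _ = ∑ x ∈ w.support, w x • A x b := by
        rw [Finset.sum_congr rfl fun x hx => by rw [hAw x hx]]
        simp
    _ = A y b := by
        rw [← hw.sum_smul_affineMap subset_rfl A, Finset.sum_apply]
        rfl

/-- The barycentric coordinates of a triangulation, as points of the standard simplex over its set
of vertices. -/
def toStdSimplex (hΦ : IsTriangulation Ω B Φ) (σ : Ω) : stdSimplex ℝ B :=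
  ⟨fun b => Φ σ b, fun b => (hΦ.hasBarycenter σ σ.2).nonneg b,
    (Finset.sum_coe_sort B fun b => Φ σ b).trans
      ((hΦ.hasBarycenter σ σ.2).sum_eq_one (hΦ.support_subset σ σ.2))⟩

@[simp]
theorem toStdSimplex_apply (hΦ : IsTriangulation Ω B Φ) (σ : Ω) (b : B) :
    (hΦ.toStdSimplex σ : B → ℝ) b = Φ σ b :=
  rfl

theorem toStdSimplex_injective (hΦ : IsTriangulation Ω B Φ) :
    Function.Injective hΦ.toStdSimplex := by
  intro σ τ h
  have hcoord (b : B) : Φ σ b = Φ τ b := by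
    simp only [← hΦ.toStdSimplex_apply, h]
  apply Subtype.ext
  rw [← (hΦ.hasBarycenter σ σ.2).sum_smul_eq (hΦ.support_subset σ σ.2),
    ← (hΦ.hasBarycenter τ τ.2).sum_smul_eq (hΦ.support_subset τ τ.2)]
  exact Finset.sum_congr rfl fun b hb => by rw [hcoord ⟨b, hb⟩]

theorem isPiecewiseLinear_toStdSimplex (hΦ : IsTriangulation Ω B Φ) (hΩ : Convex ℝ Ω)
    (hB : (B : Set E) ⊆ Ω) :
    IsPiecewiseLinear fun σ : Ω => (hΦ.toStdSimplex σ : B → ℝ) := by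
  refine ⟨(fun σ => convexHull ℝ ((Φ σ).support : Set E)) '' Ω, ?_, ?_, ?_, ?_⟩
  · refine (B.powerset.finite_toSet.image fun s : Finset E => convexHull ℝ (s : Set E)).subset ?_
    rintro _ ⟨σ, hσ, rfl⟩
    exact ⟨(Φ σ).support, by simpa using hΦ.support_subset σ hσ, rfl⟩
  · rintro _ ⟨σ, -, rfl⟩
    exact ⟨_, Finset.finite_toSet _, rfl⟩
  · refine Set.Subset.antisymm (Set.sUnion_subset ?_) fun σ hσ => ?_
    · rintro _ ⟨σ, hσ, rfl⟩
      exact convexHull_min (fun b hb => hB (hΦ.support_subset σ hσ hb)) hΩ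
    · exact ⟨_, ⟨σ, hσ, rfl⟩, (hΦ.hasBarycenter σ hσ).mem_convexHull⟩
  · rintro _ ⟨σ, hσ, rfl⟩
    obtain ⟨A, hA⟩ := hΦ.exists_affineMap_eq_on_convexHull_support hσ (B : Set E)
    exact ⟨A, fun y hy => funext fun b => hA y hy b⟩

theorem exists_lipschitzWith_toStdSimplex (hΦ : IsTriangulation Ω B Φ) :
    ∃ κ : ℝ≥0, LipschitzWith κ fun σ : Ω =>
      (WithLp.toLp 2 (hΦ.toStdSimplex σ : B → ℝ) : EuclideanSpace ℝ B) := by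
  choose K hK using hΦ.lipschitz
  have hsup : LipschitzWith (∑ b : B, K b) fun σ : Ω => (hΦ.toStdSimplex σ : B → ℝ) := by
    refine LipschitzWith.of_dist_le_mul fun x y => (dist_pi_le_iff (by positivity)).2 fun b => ?_
    refine ((hK b).dist_le_mul x x.2 y y.2).trans (mul_le_mul_of_nonneg_right ?_ dist_nonneg)
    exact_mod_cast Finset.single_le_sum (f := fun b : B => K b) (fun _ _ => zero_le)
      (Finset.mem_univ b)
  exact ⟨_, (PiLp.lipschitzWith_toLp 2 fun _ : B => ℝ).comp hsup⟩

end IsTriangulation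

section Fibers

variable {J E : Type*} [Fintype J] [AddCommGroup E] [Module ℝ E]

/-- The points of the standard simplex which `T` sends to `σ`. -/
def simplexFiber (T : (J → ℝ) →ₗ[ℝ] E) (σ : E) : Set (J → ℝ) :=
  {q | q ∈ stdSimplex ℝ J ∧ T q = σ}

theorem convex_simplexFiber (T : (J → ℝ) →ₗ[ℝ] E) (σ : E) : Convex ℝ (simplexFiber T σ) :=
  (convex_stdSimplex ℝ J).inter ((convex_singleton σ).linear_preimage T)

theorem isCompact_simplexFiber [TopologicalSpace E] [IsTopologicalAddGroup E] [ContinuousSMul ℝ E]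
    [T1Space E] (T : (J → ℝ) →ₗ[ℝ] E) (σ : E) : IsCompact (simplexFiber T σ) :=
  (isCompact_stdSimplex ℝ J).inter_right
    (isClosed_singleton.preimage (LinearMap.continuous_of_finiteDimensional T))

variable {T : (J → ℝ) →ₗ[ℝ] E} {σ : E} {q : J → ℝ}

theorem eq_zero_of_mem_extremePoints_simplexFiber (hq : q ∈ (simplexFiber T σ).extremePoints ℝ)
    {z : J → ℝ} (hz : ∀ j, q j = 0 → z j = 0) (hT : T z = 0) (hsum : ∑ j, z j = 0) : z = 0 := by
  classical
  obtain ⟨⟨⟨hq0, hq1⟩, hqσ⟩, hext⟩ := hq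
  obtain ⟨t, ht, hle⟩ := exists_pos_forall_mul_abs_le (s := Finset.univ.filter fun j => q j ≠ 0)
    (w := q) (fun j hj => (hq0 j).lt_of_ne' (Finset.mem_filter.1 hj).2) z
  have hmem (s : ℝ) (hs : |s| = t) : q + s • z ∈ simplexFiber T σ := by
    refine ⟨⟨fun j => ?_, ?_⟩, by simp [hT, hqσ]⟩
    · by_cases hj : q j = 0
      · simp [hj, hz j hj]
      · have hbound := hle j (by simp [hj])
        rw [← hs, ← abs_mul] at hbound
        simp only [Pi.add_apply, Pi.smul_apply, smul_eq_mul]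
        linarith [neg_abs_le (s * z j)]
    · simp [Finset.sum_add_distrib, ← Finset.mul_sum, hsum, hq1]
  have hseg := hext (hmem t (abs_of_pos ht)) (hmem (-t) (by rw [abs_neg, abs_of_pos ht]))
    ⟨1 / 2, 1 / 2, by norm_num, by norm_num, by norm_num, by module⟩
  exact (smul_eq_zero.1 (add_eq_left.1 hseg)).resolve_left ht.ne'

theorem HasBarycenter.sum_smul_simplexFiber_subset {w : E →₀ ℝ} {B : Finset E}
    (hw : HasBarycenter w σ) (hB : w.support ⊆ B) :
    ∑ b : B, w b • simplexFiber T b ⊆ simplexFiber T σ := by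
  intro x hx
  obtain ⟨g, hg, rfl⟩ := (Set.mem_fintype_sum _ _).1 hx
  choose y hy hyg using fun b => Set.mem_smul_set.1 (hg b)
  simp only [← hyg]
  refine ⟨(convex_stdSimplex ℝ J).sum_mem (fun b _ => hw.nonneg b) ?_ fun b _ => (hy b).1, ?_⟩
  · exact (Finset.sum_coe_sort B fun b => w b).trans (hw.sum_eq_one hB)
  · simp only [map_sum, map_smul, (hy _).2]
    exact (Finset.sum_coe_sort B fun b => w b • b).trans (hw.sum_smul_eq hB)

variable [DecidableEq J]

theorem affineIndependent_of_mem_extremePoints_simplexFiber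
    (hq : q ∈ (simplexFiber T σ).extremePoints ℝ) :
    AffineIndependent ℝ fun j : {j // q j ≠ 0} => T (Pi.single (j : J) 1) := by
  refine affineIndependent_iff.2 fun s w hmass hmoment i hi => ?_
  have hsingle (j : J) (t : ℝ) : T (Pi.single j t) = t • T (Pi.single j 1) := by
    rw [← map_smul, ← Pi.single_smul, smul_eq_mul, mul_one]
  have hzero : ∑ j ∈ s, Pi.single (j : J) (w j) = (0 : J → ℝ) := by
    refine eq_zero_of_mem_extremePoints_simplexFiber hq (fun k hk => ?_) ?_ ?_
    · rw [Finset.sum_apply]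
      refine Finset.sum_eq_zero fun j _ => Pi.single_eq_of_ne ?_ _
      rintro rfl
      exact j.2 hk
    · rw [map_sum]
      exact (Finset.sum_congr rfl fun j _ => hsingle _ (w j)).trans hmoment
    · simp only [Finset.sum_apply]
      rw [Finset.sum_comm]
      simpa using hmass
  have hi0 := congrFun hzero (i : J)
  simpa [Finset.sum_apply, Pi.single_apply, ← Subtype.ext_iff, hi] using hi0

theorem mem_convexHull_single_of_mem_stdSimplex (hq : q ∈ stdSimplex ℝ J) :
    q ∈ convexHull ℝ ((fun j => Pi.single j (1 : ℝ)) '' {j | q j ≠ 0}) := by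
  have hmass : ∑ j with q j ≠ 0, q j = 1 := (Finset.sum_filter_ne_zero _).trans hq.2
  have hmoment : ∑ j with q j ≠ 0, q j • (Pi.single j 1 : J → ℝ) = q := by
    ext k
    simp +contextual [Finset.sum_apply, Pi.single_apply, eq_comm]
  have hmem := (convex_convexHull ℝ ((fun j => Pi.single j (1 : ℝ)) '' {j | q j ≠ 0})).sum_mem
    (fun j _ => hq.1 j) hmass fun j hj =>
      subset_convexHull ℝ _ ⟨j, (Finset.mem_filter.1 hj).2, rfl⟩
  rwa [hmoment] at hmem

theorem exists_affineMap_mem_simplexFiber (hq : q ∈ (simplexFiber T σ).extremePoints ℝ) :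
    ∃ A : E →ᵃ[ℝ] (J → ℝ), A σ = q ∧
      ∀ y ∈ convexHull ℝ ((fun j => T (Pi.single j 1)) '' {j | q j ≠ 0}),
        A y ∈ simplexFiber T y := by
  obtain ⟨A, hA⟩ := exists_affineMap_apply_eq_of_affineIndependent
    (affineIndependent_of_mem_extremePoints_simplexFiber hq) fun j => (Pi.single (j : J) 1 : J → ℝ)
  refine ⟨A, ?_, fun y hy => ?_⟩
  · have hfix : convexHull ℝ ((fun j => Pi.single j (1 : ℝ)) '' {j | q j ≠ 0}) ⊆
        {x | A.comp T.toAffineMap x = AffineMap.id ℝ _ x} := by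
      refine convexHull_min ?_ (convex_eqLocus_affineMap _ _)
      rintro _ ⟨j, hj, rfl⟩
      exact hA ⟨j, hj⟩
    rw [← hq.1.2]
    exact hfix (mem_convexHull_single_of_mem_stdSimplex hq.1.1)
  · refine convexHull_min ?_ (((convex_stdSimplex ℝ J).affine_preimage A).inter
      (convex_eqLocus_affineMap (T.toAffineMap.comp A) (AffineMap.id ℝ E))) hy
    rintro _ ⟨j, hj, rfl⟩
    have hAj : A (T (Pi.single j 1)) = Pi.single j 1 := hA ⟨j, hj⟩
    exact ⟨Set.mem_preimage.2 (hAj.symm ▸ single_mem_stdSimplex ℝ j), congrArg T hAj⟩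

theorem image_stdSimplex_eq_convexHull (T : (J → ℝ) →ₗ[ℝ] E) :
    T '' stdSimplex ℝ J = convexHull ℝ (Set.range fun j => T (Pi.single j 1)) := by
  rw [← convexHull_rangle_single_eq_stdSimplex, T.image_convexHull, ← Set.range_comp]
  rfl

end Fibers

section FiberDecomposition

variable {J E : Type*} [Fintype J] [DecidableEq J] [NormedAddCommGroup E] [NormedSpace ℝ E]
  {T : (J → ℝ) →ₗ[ℝ] E} {σ : E} {B : Finset E} {Φ : E → E →₀ ℝ}

namespace IsTriangulation

theorem extremePoints_simplexFiber_subset (hΦ : IsTriangulation (T '' stdSimplex ℝ J) B Φ)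
    (hB : (B : Set E) ⊆ T '' stdSimplex ℝ J)
    (hsub : ∀ s ⊆ Set.range fun j => T (Pi.single j 1), AffineIndependent ℝ ((↑) : s → E) →
      IsSubcomplex (T '' stdSimplex ℝ J) Φ (convexHull ℝ s)) :
    (simplexFiber T σ).extremePoints ℝ ⊆ ∑ b : B, Φ σ b • simplexFiber T b := by
  intro q hq
  have hσ : σ ∈ T '' stdSimplex ℝ J := ⟨q, hq.1⟩
  obtain ⟨A, hAσ, hA⟩ := exists_affineMap_mem_simplexFiber hq
  have hind := (affineIndependent_of_mem_extremePoints_simplexFiber hq).range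
  have hσs : σ ∈ convexHull ℝ ((fun j => T (Pi.single j 1)) '' {j | q j ≠ 0}) := by
    have := Set.mem_image_of_mem T (mem_convexHull_single_of_mem_stdSimplex hq.1.1)
    rwa [T.image_convexHull, Set.image_image, hq.1.2] at this
  have hsupp : ((Φ σ).support : Set E) ⊆
      convexHull ℝ ((fun j => T (Pi.single j 1)) '' {j | q j ≠ 0}) := by
    rw [Set.image_eq_range] at hσs ⊢
    exact hsub _ (Set.range_comp_subset_range _ _) hind σ hσ hσs
  refine (Set.mem_fintype_sum _ _).2 ⟨fun b => Φ σ b • A b, fun b => ?_, ?_⟩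
  · by_cases hb : Φ σ b = 0
    · obtain ⟨x, hx⟩ := hB b.2
      exact ⟨x, hx, by simp [hb]⟩
    · exact Set.smul_mem_smul_set (hA b (hsupp (Finsupp.mem_support_iff.2 hb)))
  · rw [Finset.sum_coe_sort B fun b => Φ σ b • A b, ← hAσ]
    exact (hΦ.hasBarycenter σ hσ).sum_smul_affineMap (hΦ.support_subset σ hσ) A

theorem simplexFiber_eq_sum (hΦ : IsTriangulation (T '' stdSimplex ℝ J) B Φ)
    (hB : (B : Set E) ⊆ T '' stdSimplex ℝ J)
    (hsub : ∀ s ⊆ Set.range fun j => T (Pi.single j 1), AffineIndependent ℝ ((↑) : s → E) →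
      IsSubcomplex (T '' stdSimplex ℝ J) Φ (convexHull ℝ s))
    (hσ : σ ∈ T '' stdSimplex ℝ J) :
    simplexFiber T σ = ∑ b : B, Φ σ b • simplexFiber T b := by
  refine Set.Subset.antisymm ?_
    ((hΦ.hasBarycenter σ hσ).sum_smul_simplexFiber_subset (hΦ.support_subset σ hσ))
  have hconvex : Convex ℝ (∑ b : B, Φ σ b • simplexFiber T b) :=
    convex_sum _ fun b _ => (convex_simplexFiber T b).smul (Φ σ b)
  have hcompact : IsCompact (∑ b : B, Φ σ b • simplexFiber T b) :=
    Finset.sum_induction _ IsCompact (fun _ _ => IsCompact.add) isCompact_singleton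
      fun b _ => (isCompact_simplexFiber T b).smul (Φ σ b)
  rw [← closure_convexHull_extremePoints (isCompact_simplexFiber T σ) (convex_simplexFiber T σ)]
  exact closure_minimal
    (convexHull_min (hΦ.extremePoints_simplexFiber_subset hB hsub) hconvex) hcompact.isClosed

end IsTriangulation

end FiberDecomposition

theorem exists_isTriangulation_simplexFiber_eq_sum {J E : Type*} [Fintype J]
    [NormedAddCommGroup E] [NormedSpace ℝ E] [FiniteDimensional ℝ E] (T : (J → ℝ) →ₗ[ℝ] E) :
    ∃ B Φ, IsTriangulation (T '' stdSimplex ℝ J) B Φ ∧ (B : Set E) ⊆ T '' stdSimplex ℝ J ∧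
      ∀ σ ∈ T '' stdSimplex ℝ J, simplexFiber T σ = ∑ b : B, Φ σ b • simplexFiber T b := by
  classical
  obtain ⟨B, Φ, hΦ, hB, hsub⟩ := exists_isTriangulation_convexHull
    (Set.finite_range fun j => T (Pi.single j 1))
  rw [← image_stdSimplex_eq_convexHull] at hΦ hB hsub
  exact ⟨B, Φ, hΦ, hB, fun σ hσ => hΦ.simplexFiber_eq_sum hB hsub hσ⟩

namespace PartialMonitoringGame

variable {I J S : Type*} [Fintype J] [Fintype S] {d : ℕ}

/-- The signal map as a linear map on `ℝ^J`. -/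
noncomputable def signalLinear (G : PartialMonitoringGame I J S d) :
    (J → ℝ) →ₗ[ℝ] EuclideanSpace ℝ (I × S) where
  toFun q := WithLp.toLp 2 fun x => ∑ j, q j * (G.H x.1 j : S → ℝ) x.2
  map_add' q q' := by
    ext x
    simp [add_mul, Finset.sum_add_distrib]
  map_smul' t q := by
    ext x
    simp [mul_assoc, Finset.mul_sum]

/-- The payoff of a mixed action of the first player as a linear map on `ℝ^J`. -/
noncomputable def payoffLinear [Fintype I] (G : PartialMonitoringGame I J S d)
    (p : stdSimplex ℝ I) : (J → ℝ) →ₗ[ℝ] EuclideanSpace ℝ (Fin d) where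
  toFun q := ∑ i, ∑ j, ((p : I → ℝ) i * q j) • G.r i j
  map_add' q q' := by
    simp only [Pi.add_apply, mul_add, add_smul, Finset.sum_add_distrib]
  map_smul' t q := by
    simp only [Pi.smul_apply, smul_eq_mul, Finset.smul_sum, smul_smul, RingHom.id_apply,
      mul_left_comm]

theorem feasible_eq_image (G : PartialMonitoringGame I J S d) :
    G.feasible = G.signalLinear '' stdSimplex ℝ J := by
  ext σ
  constructor
  · rintro ⟨q, rfl⟩
    exact ⟨q, q.2, rfl⟩
  · rintro ⟨q, hq, rfl⟩
    exact ⟨⟨q, hq⟩, rfl⟩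

theorem setPayoff_eq_image [Fintype I] (G : PartialMonitoringGame I J S d)
    (p : stdSimplex ℝ I) (σ : EuclideanSpace ℝ (I × S)) :
    G.setPayoff p σ = G.payoffLinear p '' simplexFiber G.signalLinear σ := by
  ext x
  constructor
  · rintro ⟨q, hq, rfl⟩
    exact ⟨q, ⟨q.2, hq⟩, rfl⟩
  · rintro ⟨q, ⟨hq, hqσ⟩, rfl⟩
    exact ⟨⟨q, hq⟩, hqσ, rfl⟩

theorem convex_feasible (G : PartialMonitoringGame I J S d) : Convex ℝ G.feasible := by
  rw [feasible_eq_image]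
  exact (convex_stdSimplex ℝ J).linear_image _

theorem setPayoff_eq_sum [Fintype I] (G : PartialMonitoringGame I J S d) (p : stdSimplex ℝ I)
    {ι : Type*} [Fintype ι] {σ : EuclideanSpace ℝ (I × S)} {w : ι → ℝ}
    {b : ι → EuclideanSpace ℝ (I × S)}
    (h : simplexFiber G.signalLinear σ = ∑ i, w i • simplexFiber G.signalLinear (b i)) :
    G.setPayoff p σ = ∑ i, w i • G.setPayoff p (b i) := by
  simp only [setPayoff_eq_image, h, Set.image_finsetSum, image_smul_set]

end PartialMonitoringGame

theorem mainTheorem9 {I J S : Type*} [Fintype I] [Fintype J] [Fintype S] {d : ℕ}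
    (G : PartialMonitoringGame I J S d) :
    ∃ (B : Finset (EuclideanSpace ℝ (I × S))) (Φ : G.feasible → stdSimplex ℝ B),
      (B : Set (EuclideanSpace ℝ (I × S))) ⊆ G.feasible ∧
      IsPiecewiseLinear (fun σ => (Φ σ : B → ℝ)) ∧
      Function.Injective Φ ∧
      (∀ (p : stdSimplex ℝ I) (σ : G.feasible),
        G.setPayoff p σ = ∑ b : B, (Φ σ : B → ℝ) b • G.setPayoff p b) ∧
      ∃ κ : ℝ≥0, LipschitzWith κ
        (fun σ => (WithLp.toLp 2 (Φ σ : B → ℝ) : EuclideanSpace ℝ B)) := by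
  obtain ⟨B, Φ, hΦ, hB, hfiber⟩ := exists_isTriangulation_simplexFiber_eq_sum G.signalLinear
  rw [← G.feasible_eq_image] at hΦ hB hfiber
  exact ⟨B, hΦ.toStdSimplex, hB, hΦ.isPiecewiseLinear_toStdSimplex G.convex_feasible hB,
    hΦ.toStdSimplex_injective, fun p σ => G.setPayoff_eq_sum p (hfiber σ σ.2),
    hΦ.exists_lipschitzWith_toStdSimplex⟩
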